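/- Let $\mathbb{N}=\{1,2,3,\dots\}$ and let $a\in[0,1)$. Let $J_a$ be the Jacobi operator on $\ell^2(\mathbb{N})$ given by $$(J_a\psi)_1=a\psi_1+\psi_2,\qquad (J_a\psi)_n=\psi_{n-1}+\psi_{n+1}\quad (n\ge 2),$$ let $v=(v_n)_{n\ge1}$ be a sequence of complex numbers and $V=\operatorname{diag}(v_1,v_2,\dots)$. Put $q_a:=\min\left(\log_2(2-a),\tfrac12\right)$ and let $q\in(0,q_a]$. (i) If there is a real constant $c<1$ such that $$|v_n|\le c\left[2-\left(1-\frac1n\right)^q-\left(1+\frac1n\right)^q-a\,\delta_{n,1}\right]\qquad\text{for all } n\in\mathbb{N},\tag{$*$}$$ then $V$ is bounded and $\sigma(J_a+V)=\sigma_{\mathrm c}(J_a+V)=[-2,2]$. (ii) If $(*)$ holds with $c=1$, then $V$ is bounded and $\sigma_{\mathrm d}(J_a+V)=\emptyset$. Here, for a bounded operator $T$, $\sigma(T)$ is the spectrum, $\sigma_{\mathrm c}(T)$ is the continuous spectrum (the $z\in\mathbb{C}$ for which $T-z$ is injective with dense range but not surjective), and $\sigma_{\mathrm d}(T)$ is the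 discrete spectrum (the eigenvalues of $T$ that are isolated points of $\sigma(T)$ and have finite algebraic multiplicity, i.e. whose Riesz spectral projection has finite rank). -/

import Mathlib

open scoped ENNReal

namespace RobinSchrodinger

/-- The Hilbert space of square summable complex sequences indexed by `{1, 2, 3, …}`. -/
abbrev H : Type := lp (fun _ : ℕ+ => ℂ) 2

/-- The entry preceding the `n`-th one, with the convention `u 0 = 0`. -/
def prev (u : ℕ+ → ℂ) (n : ℕ+) : ℂ := if n = 1 then 0 else u (n - 1)

theorem prev_one (u : ℕ+ → ℂ) : prev u 1 = 0 := by simp [prev]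

theorem prev_add_one (u : ℕ+ → ℂ) (n : ℕ+) : prev u (n + 1) = u n := by
  have h : n + 1 ≠ 1 := (PNat.lt_add_left 1 n).ne'
  have h' : n + 1 - 1 = n := PNat.add_sub
  simp [prev, h, h']

theorem hasSum_norm_sq (u : H) : HasSum (fun n => ‖u n‖ ^ (2 : ℝ)) (‖u‖ ^ (2 : ℝ)) := by
  simpa using lp.hasSum_norm (p := 2) (by norm_num) u

theorem hasSum_prev (u : H) : HasSum (fun n => ‖prev u n‖ ^ (2 : ℝ)) (‖u‖ ^ (2 : ℝ)) := by
  have hinj : Function.Injective (fun n : ℕ+ => n + 1) := add_left_injective 1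
  refine (hinj.hasSum_iff ?_).1 ?_
  · intro n hn
    have : n = 1 := by
      by_contra h
      exact hn ⟨n - 1, PNat.sub_add_of_lt (lt_of_le_of_ne one_le (Ne.symm h))⟩
    subst this
    simp [prev_one]
  · simpa [Function.comp_def, prev_add_one] using hasSum_norm_sq u

theorem memℓp_prev (u : H) : Memℓp (prev u) 2 :=
  memℓp_gen (by simpa using (hasSum_prev u).summable)

theorem summable_next (u : H) : Summable (fun n : ℕ+ => ‖u (n + 1)‖ ^ (2 : ℝ)) :=
  (hasSum_norm_sq u).summable.comp_injective (add_left_injective (1 : ℕ+))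

theorem tsum_next_le (u : H) :
    ∑' n : ℕ+, ‖u (n + 1)‖ ^ (2 : ℝ) ≤ ‖u‖ ^ (2 : ℝ) := by
  have hinj : Function.Injective (fun n : ℕ+ => n + 1) := add_left_injective 1
  refine hasSum_le_inj (fun n : ℕ+ => n + 1) hinj ?_ ?_ (summable_next u).hasSum (hasSum_norm_sq u)
  · intro n _
    positivity
  · intro n
    exact le_rfl

theorem memℓp_next (u : H) : Memℓp (fun n : ℕ+ => u (n + 1)) 2 :=
  memℓp_gen (by simpa using summable_next u)

/-- The forward shift `(u₁, u₂, …) ↦ (0, u₁, u₂, …)`. -/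
noncomputable def shiftRight : H →L[ℂ] H :=
  LinearMap.mkContinuous
    { toFun := fun u => ⟨prev u, memℓp_prev u⟩
      map_add' := fun u w => by
        ext n
        change prev (u + w : H) n = prev u n + prev w n
        by_cases h : n = 1 <;> simp [prev, h]
      map_smul' := fun c u => by
        ext n
        by_cases h : n = 1 <;> simp [prev, h] }
    1 (fun u => lp.norm_le_of_tsum_le (p := 2) (by norm_num) (by positivity) (by
      simpa using (hasSum_prev u).tsum_eq.le))

/-- The backward shift `(u₁, u₂, u₃, …) ↦ (u₂, u₃, …)`. -/
noncomputable def shiftLeft : H →L[ℂ] H :=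
  LinearMap.mkContinuous
    { toFun := fun u => ⟨fun n => u (n + 1), memℓp_next u⟩
      map_add' := fun u w => rfl
      map_smul' := fun c u => rfl }
    1 (fun u => lp.norm_le_of_tsum_le (p := 2) (by norm_num) (by positivity) (by
      rw [one_mul, ENNReal.toReal_ofNat]
      exact tsum_next_le u))

/-- The diagonal operator `diag(v₁, v₂, …)` of a bounded sequence `v`. -/
noncomputable def diag (v : ℕ+ → ℂ) (hv : Memℓp v ∞) : H →L[ℂ] H :=
  lp.mapCLM (E := fun _ : ℕ+ => ℂ) (F := fun _ : ℕ+ => ℂ) 2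
    (fun n => v n • ContinuousLinearMap.id ℂ ℂ)
    (K := ‖(⟨v, hv⟩ : lp (fun _ : ℕ+ => ℂ) ∞)‖) (norm_nonneg _) (fun n => by
      simpa [norm_smul] using
        lp.norm_apply_le_norm ENNReal.top_ne_zero (⟨v, hv⟩ : lp (fun _ : ℕ+ => ℂ) ∞) n)

theorem memℓp_corner (a : ℂ) : Memℓp (fun n : ℕ+ => if n = 1 then a else 0) ∞ :=
  memℓp_infty ⟨‖a‖, by rintro _ ⟨n, rfl⟩; by_cases h : n = 1 <;> simp [h]⟩

/-- The Jacobi operator `J_a`: ones on the two off-diagonals, diagonal `(a, 0, 0, …)`. -/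
noncomputable def J (a : ℂ) : H →L[ℂ] H :=
  shiftRight + shiftLeft + diag (fun n => if n = 1 then a else 0) (memℓp_corner a)

theorem diag_apply (v : ℕ+ → ℂ) (hv : Memℓp v ∞) (u : H) (n : ℕ+) :
    diag v hv u n = v n * u n := by
  simp [diag, lp.mapCLM]

theorem J_apply_one (a : ℂ) (u : H) : J a u 1 = a * u 1 + u 2 := by
  have h : J a u 1 = prev u 1 + u (1 + 1) +
      diag (fun n => if n = 1 then a else 0) (memℓp_corner a) u 1 := rfl
  rw [h, diag_apply, prev_one, show (1 + 1 : ℕ+) = 2 from rfl]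
  simp [add_comm]

theorem J_apply_add_one (a : ℂ) (u : H) (n : ℕ+) :
    J a u (n + 1) = u n + u (n + 2) := by
  have h : J a u (n + 1) = prev u (n + 1) + u (n + 1 + 1) +
      diag (fun n => if n = 1 then a else 0) (memℓp_corner a) u (n + 1) := rfl
  rw [h, diag_apply, prev_add_one, add_assoc n, show (1 + 1 : ℕ+) = 2 from rfl]
  simp [(PNat.lt_add_left 1 n).ne']

section Spectra

variable {E : Type*} [NormedAddCommGroup E] [NormedSpace ℂ E]

/-- The continuous spectrum: `T - z` is injective with dense range, but not surjective. -/
def continuousSpectrum (T : E →L[ℂ] E) : Set ℂ :=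
  {z | Function.Injective (T - algebraMap ℂ (E →L[ℂ] E) z) ∧
    DenseRange (T - algebraMap ℂ (E →L[ℂ] E) z) ∧
    ¬ Function.Surjective (T - algebraMap ℂ (E →L[ℂ] E) z)}

/-- The Riesz integral `(2πi)⁻¹ ∮ (w - T)⁻¹ dw` over the circle `|w - z| = r`. It is the spectral
projection of `T` onto `{z}` if `z` is the only spectral point in the closed disc. -/
noncomputable def rieszProjection (T : E →L[ℂ] E) (z : ℂ) (r : ℝ) : E →L[ℂ] E :=
  (2 * Real.pi * Complex.I : ℂ)⁻¹ • ∮ w in C(z, r), resolvent T w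

/-- The discrete spectrum: the eigenvalues of `T` that are isolated points of the spectrum and have
finite algebraic multiplicity, that is, a spectral projection of finite rank. -/
def discreteSpectrum (T : E →L[ℂ] E) : Set ℂ :=
  {z | Module.End.HasEigenvalue (T : E →ₗ[ℂ] E) z ∧
    ∃ r : ℝ, 0 < r ∧ Metric.closedBall z r ∩ spectrum ℂ T = {z} ∧
      FiniteDimensional ℂ (LinearMap.range (rieszProjection T z r : E →ₗ[ℂ] E))}

end Spectra

/-- `q_a = min (log₂ (2 - a), 1/2)`. -/
noncomputable def qMax (a : ℝ) : ℝ := min (Real.logb 2 (2 - a)) (1 / 2)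

/-- `w_n = 2 - (1 - 1/n)^q - (1 + 1/n)^q - a δ_{n,1}`. -/
noncomputable def hardyWeight (a q : ℝ) (n : ℕ+) : ℝ :=
  2 - (1 - 1 / (n : ℝ)) ^ q - (1 + 1 / (n : ℝ)) ^ q - a * (if n = 1 then 1 else 0)

/-- The real interval `[-2, 2]` as a set of complex numbers. -/
def interval : Set ℂ := Complex.ofReal '' Set.Icc (-2) 2

end RobinSchrodinger

/-!
Write `z = k + k⁻¹` with `0 < ‖k‖ ≤ 1`; the points of `[-2, 2]` are those with `‖k‖ = 1`. With the
forward shift `S` and the projection `P` onto the first coordinate,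
`-k (J_a - z) = (1 - kS*)(1 - akP)(1 - kS)` (`complexFlux_sub_mul`, `J_sub_eq_smul`). For `k = 1`
this factorisation writes the equation `(2 - J_a) g = w g`, satisfied by `g n = n ^ q` and the Hardy
weight `w`, as a first order recursion for `flux = (1 - aP)(1 - S) g` (`flux_sub_flux_add_one`).

Let `(J_a + V) u = z u` with `|v| ≤ c w` and `|u| ≤ M g`. Comparing the two factorisations factor by
factor, from infinity downwards for `1 - kS*` and from `1` upwards for `1 - kS`, gives the better
bound `|u| ≤ ‖k‖ c M g` (`norm_apply_le_of_norm_apply_le`). Since `u` is bounded and `g ≥ 1`, this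
can be iterated, and `u = 0` as soon as `‖k‖ c < 1` (`eq_zero_of_eigenvector`). So there are no
eigenvalues off `[-2, 2]` when `c ≤ 1`, and none at all when `c < 1`. The condition `a < 1` enters
through `‖1 - ak‖ ≥ 1 - a > 0`.

The rest is soft. Because `w n → 0`, the operator `V` is compact; off `[-2, 2]` the three factors are
invertible, and the Fredholm alternative turns the absence of eigenvalues into invertibility of
`J_a + V - z` (`spectrum_subset_interval`). Truncated plane waves far out show that `[-2, 2]` lies
in the spectrum (`not_isUnit_J_add_diag_sub`). If `c < 1`, then on `[-2, 2]` both `J_a + V - z` and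
its adjoint are injective, so these points belong to the continuous spectrum. If `c = 1`, the
spectrum is still `[-2, 2]`, which has no isolated points, so the discrete spectrum is empty.
-/

namespace RobinSchrodinger

open Filter Topology

/-! ### The Hardy weight -/

theorem qMax_le_half {a q : ℝ} (hqa : q ≤ qMax a) : q ≤ 1 / 2 :=
  hqa.trans (min_le_right _ _)

theorem two_rpow_le_two_sub {a q : ℝ} (ha1 : a < 1) (hqa : q ≤ qMax a) :
    (2 : ℝ) ^ q ≤ 2 - a :=
  (Real.le_logb_iff_rpow_le one_lt_two (by linarith)).1 (hqa.trans (min_le_left _ _))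

theorem hardyWeight_one {a q : ℝ} (hq0 : 0 < q) :
    hardyWeight a q 1 = 2 - a - (2 : ℝ) ^ q := by
  have : (1 + 1 : ℝ) = 2 := by norm_num
  simp [hardyWeight, Real.zero_rpow hq0.ne', this]
  ring

theorem hardyWeight_add_one (a q : ℝ) (n : ℕ+) : hardyWeight a q (n + 1) =
    2 - (1 - 1 / ((n : ℝ) + 1)) ^ q - (1 + 1 / ((n : ℝ) + 1)) ^ q := by
  simp [hardyWeight, (PNat.lt_add_left 1 n).ne']

/-- Past the first site this is concavity of `x ^ q`; at the first site it is the condition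
`2 ^ q ≤ 2 - a`. -/
theorem hardyWeight_nonneg {a q : ℝ} (ha1 : a < 1) (hq0 : 0 < q) (hqa : q ≤ qMax a) (n : ℕ+) :
    0 ≤ hardyWeight a q n := by
  induction n using PNat.recOn with
  | one =>
    rw [hardyWeight_one hq0]
    linarith [two_rpow_le_two_sub ha1 hqa]
  | succ n _ =>
    have hq1 : q ≤ 1 := (qMax_le_half hqa).trans (by norm_num)
    have hx : (0 : ℝ) ≤ 1 / ((n : ℝ) + 1) := by positivity
    have hx1 : 1 / ((n : ℝ) + 1) ≤ 1 := by
      rw [div_le_one (by positivity)]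
      linarith [Nat.cast_nonneg (α := ℝ) (n : ℕ)]
    have h1 := rpow_one_add_le_one_add_mul_self
      (s := -(1 / ((n : ℝ) + 1))) (by linarith) hq0.le hq1
    have h2 := rpow_one_add_le_one_add_mul_self
      (s := 1 / ((n : ℝ) + 1)) (by linarith) hq0.le hq1
    rw [hardyWeight_add_one, sub_eq_add_neg (1 : ℝ)]
    linarith

theorem tendsto_pnat_cast_atTop : Tendsto (fun n : ℕ+ => (n : ℝ)) atTop atTop :=
  tendsto_natCast_atTop_atTop.comp tendsto_PNat_val_atTop_atTop

theorem tendsto_hardyWeight (a q : ℝ) :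
    Tendsto (hardyWeight a q) atTop (𝓝 0) := by
  have hinv : Tendsto (fun n : ℕ+ => 1 / (n : ℝ)) atTop (𝓝 0) := by
    simpa [Function.comp_def] using tendsto_inv_atTop_zero.comp tendsto_pnat_cast_atTop
  have h1 : Tendsto (fun n : ℕ+ => (1 - 1 / (n : ℝ)) ^ q) atTop (𝓝 1) := by
    simpa using ((tendsto_const_nhds (x := (1 : ℝ))).sub hinv).rpow_const (p := q)
      (Or.inl (by norm_num))
  have h2 : Tendsto (fun n : ℕ+ => (1 + 1 / (n : ℝ)) ^ q) atTop (𝓝 1) := by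
    simpa using ((tendsto_const_nhds (x := (1 : ℝ))).add hinv).rpow_const (p := q)
      (Or.inl (by norm_num))
  have h3 : Tendsto (fun n : ℕ+ => 2 - (1 - 1 / (n : ℝ)) ^ q - (1 + 1 / (n : ℝ)) ^ q)
      atTop (𝓝 0) := by
    convert (tendsto_const_nhds (x := (2 : ℝ)).sub h1).sub h2 using 2
    norm_num
  refine h3.congr' ?_
  filter_upwards [eventually_gt_atTop 1] with n hn
  simp [hardyWeight, hn.ne']

/-! ### The flux of `n ^ q` -/

/-- The sequence `(1 - aP)(1 - S)g` for `g n = n ^ q`, where `S` is the forward shift and `P` the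
projection onto the first coordinate; explicitly `n ^ q - (n - 1) ^ q - a δ_{n,1}`. -/
noncomputable def flux (a q : ℝ) (n : ℕ+) : ℝ :=
  (n : ℝ) ^ q - ((n : ℝ) - 1) ^ q - a * (if n = 1 then 1 else 0)

theorem flux_one {a q : ℝ} (hq0 : 0 < q) : flux a q 1 = 1 - a := by
  simp [flux, Real.zero_rpow hq0.ne']

theorem flux_add_one (a q : ℝ) (n : ℕ+) :
    flux a q (n + 1) = ((n : ℝ) + 1) ^ q - (n : ℝ) ^ q := by
  simp [flux, (PNat.lt_add_left 1 n).ne']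

theorem flux_nonneg {a q : ℝ} (ha1 : a < 1) (hq0 : 0 < q) (n : ℕ+) : 0 ≤ flux a q n := by
  induction n using PNat.recOn with
  | one => rw [flux_one hq0]; linarith
  | succ n _ =>
    rw [flux_add_one, sub_nonneg]
    exact Real.rpow_le_rpow (by positivity) (by linarith) hq0.le

/-- The power `n ^ q` solves `(2 - J_a) g = w g`: its flux loses `w n * n ^ q` at each step. -/
theorem flux_sub_flux_add_one {a q : ℝ} (n : ℕ+) :
    flux a q n - flux a q (n + 1) = hardyWeight a q n * (n : ℝ) ^ q := by
  have hn : (0 : ℝ) < n := Nat.cast_pos.2 n.pos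
  have hn1 : (1 : ℝ) ≤ n := Nat.one_le_cast.2 n.pos
  have hle : 1 / (n : ℝ) ≤ 1 := (div_le_one hn).2 hn1
  have h1 : (1 - 1 / (n : ℝ)) ^ q * (n : ℝ) ^ q = ((n : ℝ) - 1) ^ q := by
    rw [← Real.mul_rpow (by linarith) hn.le]
    congr 1
    field_simp
  have h2 : (1 + 1 / (n : ℝ)) ^ q * (n : ℝ) ^ q = ((n : ℝ) + 1) ^ q := by
    rw [← Real.mul_rpow (by positivity) hn.le]
    congr 1
    field_simp
  have h3 : a * (if n = 1 then (1 : ℝ) else 0) * (n : ℝ) ^ q = a * (if n = 1 then 1 else 0) := by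
    by_cases h : n = 1 <;> simp [h]
  rw [flux_add_one, flux, hardyWeight, sub_mul, sub_mul, sub_mul, h1, h2, h3]
  ring

theorem tendsto_apply_zero (u : H) : Tendsto (fun n => u n) atTop (𝓝 0) := by
  have h := (hasSum_norm_sq u).summable.tendsto_cofinite_zero
  have h2 := h.rpow_const (p := (1 / 2 : ℝ)) (Or.inr (by norm_num))
  have h3 : Tendsto (fun n => ‖u n‖) cofinite (𝓝 0) := by
    convert h2 using 2 with n
    · rw [← Real.rpow_mul (norm_nonneg _)]
      norm_num
    · rw [Real.zero_rpow (by norm_num)]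
  exact (tendsto_zero_iff_norm_tendsto_zero.2 h3).mono_left atTop_le_cofinite

/-! ### Pointwise bounds on eigenvectors -/

section Eigenvector

variable {a q c : ℝ} {k : ℂ} {v : ℕ+ → ℂ} {u : H}

/-- The sequence `(1 - akP)(1 - kS)u`, with `S` the forward shift and `P` the projection onto the
first coordinate. -/
noncomputable def complexFlux (a : ℝ) (k : ℂ) (u : ℕ+ → ℂ) (n : ℕ+) : ℂ :=
  u n - k * prev u n - a * k * (if n = 1 then u n else 0)

theorem complexFlux_one (a : ℝ) (k : ℂ) (u : ℕ+ → ℂ) :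
    complexFlux a k u 1 = (1 - a * k) * u 1 := by
  simp [complexFlux, prev_one]
  ring

theorem complexFlux_add_one (a : ℝ) (k : ℂ) (u : ℕ+ → ℂ) (n : ℕ+) :
    complexFlux a k u (n + 1) = u (n + 1) - k * u n := by
  simp [complexFlux, prev_add_one, (PNat.lt_add_left 1 n).ne']

/-- Factorisation of `J_a - (k + k⁻¹)`, applied to a vector `u`. -/
theorem complexFlux_sub_mul (a : ℝ) (hk : k ≠ 0) (u : H) (n : ℕ+) :
    complexFlux a k u n - k * complexFlux a k u (n + 1) =
      -k * (J a u n - (k + k⁻¹) * u n) := by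
  have h2 : (1 + 1 : ℕ+) = 2 := rfl
  induction n using PNat.recOn with
  | one =>
    rw [complexFlux_one, complexFlux_add_one, J_apply_one, h2]
    field_simp
    ring
  | succ n _ =>
    rw [complexFlux_add_one, complexFlux_add_one, J_apply_add_one, add_assoc n, h2]
    field_simp
    ring

/-- The flux of an eigenvector is dominated by that of `n ^ q`: the difference of the two sides
increases with `n`, and its limit is nonpositive because `u` is square summable. -/
theorem norm_complexFlux_le (ha1 : a < 1) (hq0 : 0 < q) (hc : 0 ≤ c) (hk : k ≠ 0) (hk1 : ‖k‖ ≤ 1)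
    (hv : ∀ n, ‖v n‖ ≤ c * hardyWeight a q n)
    (hu : ∀ n, J a u n + v n * u n = (k + k⁻¹) * u n) {M : ℝ} (hM : 0 ≤ M)
    (huM : ∀ n : ℕ+, ‖u n‖ ≤ M * (n : ℝ) ^ q) (n : ℕ+) :
    ‖complexFlux a k u n‖ ≤ ‖k‖ * c * M * flux a q n := by
  set d : ℕ+ → ℝ := fun n => ‖complexFlux a k u n‖ - ‖k‖ * c * M * flux a q n with hd
  have hstep : ∀ n, d n ≤ d (n + 1) := by
    intro n
    have h1 : complexFlux a k u n = k * complexFlux a k u (n + 1) + k * (v n * u n) := by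
      linear_combination complexFlux_sub_mul a hk u n - k * hu n
    have h2 : ‖complexFlux a k u n‖ ≤
        ‖k‖ * ‖complexFlux a k u (n + 1)‖ + ‖k‖ * (‖v n‖ * ‖u n‖) := by
      rw [h1, ← norm_mul, ← norm_mul, ← norm_mul]
      exact norm_add_le _ _
    have h3 : ‖v n‖ * ‖u n‖ ≤ c * hardyWeight a q n * (M * (n : ℝ) ^ q) :=
      mul_le_mul (hv n) (huM n) (norm_nonneg _) ((norm_nonneg _).trans (hv n))
    have h4 : ‖k‖ * (‖v n‖ * ‖u n‖) ≤ ‖k‖ * c * M * (flux a q n - flux a q (n + 1)) := by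
      rw [flux_sub_flux_add_one]
      calc _ ≤ ‖k‖ * (c * hardyWeight a q n * (M * (n : ℝ) ^ q)) := by gcongr
        _ = _ := by ring
    have h5 : ‖k‖ * ‖complexFlux a k u (n + 1)‖ ≤ ‖complexFlux a k u (n + 1)‖ :=
      mul_le_of_le_one_left (norm_nonneg _) hk1
    simp only [hd]
    linarith
  have hmono : ∀ j : ℕ+, d n ≤ d (n + j) := by
    intro j
    induction j using PNat.recOn with
    | one => exact hstep n
    | succ j ih => exact ih.trans ((hstep _).trans_eq (by rw [add_assoc]))
  have hbound : ∀ j : ℕ+, d n ≤ ‖u (n + j + 1)‖ + ‖k‖ * ‖u (n + j)‖ := by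
    intro j
    have h1 := hmono (j + 1)
    have h2 : 0 ≤ ‖k‖ * c * M * flux a q (n + j + 1) :=
      mul_nonneg (by positivity) (flux_nonneg ha1 hq0 _)
    rw [← add_assoc] at h1
    refine h1.trans ?_
    simp only [hd, complexFlux_add_one]
    have h3 := norm_sub_le (u (n + j + 1)) (k * u (n + j))
    rw [norm_mul] at h3
    linarith
  have hshift : Tendsto (fun j : ℕ+ => n + j) atTop atTop :=
    tendsto_atTop_mono (fun j => (PNat.lt_add_left j n).le) tendsto_id
  have hshift1 : Tendsto (fun j : ℕ+ => n + j + 1) atTop atTop :=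
    tendsto_atTop_mono (fun j => (PNat.lt_add_right _ 1).le) hshift
  have hlim : Tendsto (fun j : ℕ+ => ‖u (n + j + 1)‖ + ‖k‖ * ‖u (n + j)‖) atTop (𝓝 0) := by
    have h1 := ((tendsto_apply_zero u).comp hshift1).norm
    have h2 := (((tendsto_apply_zero u).comp hshift).norm).const_mul ‖k‖
    simpa using h1.add h2
  have := ge_of_tendsto' hlim hbound
  simp only [hd] at this
  linarith

/-- A pointwise bound by a multiple of `n ^ q` on an eigenvector improves by the factor
`‖k‖ * c`. -/
theorem norm_apply_le_of_norm_apply_le (ha0 : 0 ≤ a) (ha1 : a < 1) (hq0 : 0 < q) (hc : 0 ≤ c)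
    (hk : k ≠ 0) (hk1 : ‖k‖ ≤ 1) (hv : ∀ n, ‖v n‖ ≤ c * hardyWeight a q n)
    (hu : ∀ n, J a u n + v n * u n = (k + k⁻¹) * u n) {M : ℝ} (hM : 0 ≤ M)
    (huM : ∀ n : ℕ+, ‖u n‖ ≤ M * (n : ℝ) ^ q) (n : ℕ+) :
    ‖u n‖ ≤ ‖k‖ * c * M * (n : ℝ) ^ q := by
  have hflux := norm_complexFlux_le ha1 hq0 hc hk hk1 hv hu hM huM
  have hρ : 0 ≤ ‖k‖ * c * M := by positivity
  induction n using PNat.recOn with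
  | one =>
    have h1 := hflux 1
    rw [complexFlux_one, flux_one hq0, norm_mul] at h1
    have h2 : 1 - a ≤ ‖1 - (a : ℂ) * k‖ := by
      have h3 := norm_sub_norm_le (1 : ℂ) ((a : ℂ) * k)
      rw [norm_one, norm_mul, Complex.norm_of_nonneg ha0] at h3
      nlinarith [norm_nonneg k]
    have h4 : (1 - a) * ‖u 1‖ ≤ (1 - a) * (‖k‖ * c * M) := by
      calc _ ≤ ‖1 - (a : ℂ) * k‖ * ‖u 1‖ := by gcongr
        _ ≤ _ := h1
        _ = _ := by ring
    simpa using le_of_mul_le_mul_left h4 (by linarith)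
  | succ n ih =>
    have h1 := hflux (n + 1)
    rw [complexFlux_add_one, flux_add_one] at h1
    have h2 : ‖u (n + 1)‖ ≤ ‖u (n + 1) - k * u n‖ + ‖k‖ * ‖u n‖ := by
      rw [← norm_mul]
      simpa using norm_add_le (u (n + 1) - k * u n) (k * u n)
    have h3 : ‖k‖ * ‖u n‖ ≤ ‖u n‖ := mul_le_of_le_one_left (norm_nonneg _) hk1
    push_cast
    linarith

/-- Iterating the improved pointwise bound leaves only the zero eigenvector. -/
theorem eq_zero_of_eigenvector (ha0 : 0 ≤ a) (ha1 : a < 1) (hq0 : 0 < q) (hc : 0 ≤ c)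
    (hk : k ≠ 0) (hk1 : ‖k‖ ≤ 1) (hkc : ‖k‖ * c < 1)
    (hv : ∀ n, ‖v n‖ ≤ c * hardyWeight a q n)
    (hu : ∀ n, J a u n + v n * u n = (k + k⁻¹) * u n) : u = 0 := by
  have hρ : 0 ≤ ‖k‖ * c := by positivity
  have hiter : ∀ (j : ℕ) (n : ℕ+), ‖u n‖ ≤ (‖k‖ * c) ^ j * ‖u‖ * (n : ℝ) ^ q := by
    intro j
    induction j with
    | zero =>
      intro n
      have h1 : (1 : ℝ) ≤ (n : ℝ) ^ q := Real.one_le_rpow (Nat.one_le_cast.2 n.pos) hq0.le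
      rw [pow_zero, one_mul]
      exact (lp.norm_apply_le_norm two_ne_zero u n).trans
        (le_mul_of_one_le_right (norm_nonneg u) h1)
    | succ j ih =>
      intro n
      have := norm_apply_le_of_norm_apply_le ha0 ha1 hq0 hc hk hk1 hv hu (by positivity) ih n
      rwa [pow_succ', mul_assoc (‖k‖ * c)]
  ext n
  have hlim : Tendsto (fun j : ℕ => (‖k‖ * c) ^ j * ‖u‖ * (n : ℝ) ^ q) atTop (𝓝 0) := by
    simpa using ((tendsto_pow_atTop_nhds_zero_of_lt_one hρ hkc).mul_const ‖u‖).mul_const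
      ((n : ℝ) ^ q)
  simpa using ge_of_tendsto' hlim (fun j => hiter j n)

end Eigenvector

/-! ### Factorisation of `J_a - z` -/

theorem shiftRight_apply (u : H) (n : ℕ+) : shiftRight u n = prev u n := rfl

theorem shiftLeft_apply (u : H) (n : ℕ+) : shiftLeft u n = u (n + 1) := rfl

theorem norm_shiftRight_le : ‖shiftRight‖ ≤ 1 := LinearMap.mkContinuous_norm_le _ zero_le_one _

theorem norm_shiftLeft_le : ‖shiftLeft‖ ≤ 1 := LinearMap.mkContinuous_norm_le _ zero_le_one _

theorem norm_le_of_forall_norm_apply_le {u w : H} {C : ℝ} (hC : 0 ≤ C)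
    (h : ∀ n, ‖u n‖ ≤ C * ‖w n‖) : ‖u‖ ≤ C * ‖w‖ := by
  have hnorm : ‖(C : ℂ) • w‖ = C * ‖w‖ := by
    rw [norm_smul, Complex.norm_of_nonneg hC]
  rw [← hnorm]
  refine lp.norm_mono two_ne_zero fun n => ?_
  change ‖u n‖ ≤ ‖(C : ℂ) * w n‖
  rw [norm_mul, Complex.norm_of_nonneg hC]
  exact h n

theorem norm_diag_le {v : ℕ+ → ℂ} (hv : Memℓp v ∞) {C : ℝ} (hC : 0 ≤ C) (h : ∀ n, ‖v n‖ ≤ C) :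
    ‖diag v hv‖ ≤ C := by
  refine ContinuousLinearMap.opNorm_le_bound _ hC fun u =>
    norm_le_of_forall_norm_apply_le hC fun n => ?_
  rw [diag_apply, norm_mul]
  gcongr
  exact h n

/-- For `z = k + k⁻¹`, the operator `J_a - z` is, up to a scalar, a product of perturbations of the
identity by `k` times a contraction. -/
theorem J_sub_eq_smul (a : ℝ) {k : ℂ} (hk : k ≠ 0) :
    J a - algebraMap ℂ (H →L[ℂ] H) (k + k⁻¹) = (-k)⁻¹ •
      ((1 - k • shiftLeft) * (1 - k • diag (fun n => if n = 1 then (a : ℂ) else 0)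
        (memℓp_corner a)) * (1 - k • shiftRight)) := by
  rw [eq_inv_smul_iff₀ (neg_ne_zero.2 hk)]
  ext u n
  have hcomp : ∀ m, ((1 - k • diag (fun n => if n = 1 then (a : ℂ) else 0)
      (memℓp_corner a)) ((1 - k • shiftRight) u)) m = complexFlux a k u m := by
    intro m
    change (u m - k * prev u m) - k * diag (fun n => if n = 1 then (a : ℂ) else 0)
      (memℓp_corner a) ((1 - k • shiftRight) u) m = _
    rw [diag_apply]
    change (u m - k * prev u m) - k * ((if m = 1 then (a : ℂ) else 0) * (u m - k * prev u m)) = _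
    by_cases h : m = 1
    · subst h
      simp [complexFlux, prev_one]
      ring
    · simp [complexFlux, h]
  refine (complexFlux_sub_mul a hk u n).symm.trans ?_
  rw [← hcomp n, ← hcomp (n + 1)]
  rfl

theorem isUnit_one_sub_smul {A : H →L[ℂ] H} (hA : ‖A‖ ≤ 1) {k : ℂ} (hk : ‖k‖ < 1) :
    IsUnit (1 - k • A) := by
  refine isUnit_one_sub_of_norm_lt_one ?_
  rw [norm_smul]
  exact (mul_le_of_le_one_right (norm_nonneg k) hA).trans_lt hk

theorem isUnit_J_sub {a : ℝ} (ha0 : 0 ≤ a) (ha1 : a < 1) {k : ℂ} (hk : k ≠ 0) (hk1 : ‖k‖ < 1) :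
    IsUnit (J a - algebraMap ℂ (H →L[ℂ] H) (k + k⁻¹)) := by
  rw [J_sub_eq_smul a hk]
  have hcorner : ‖diag (fun n => if n = 1 then (a : ℂ) else 0) (memℓp_corner a)‖ ≤ 1 := by
    refine norm_diag_le _ zero_le_one fun n => ?_
    by_cases h : n = 1
    · simpa [h, abs_of_nonneg ha0] using ha1.le
    · simp [h]
  exact (((isUnit_one_sub_smul norm_shiftLeft_le hk1).mul (isUnit_one_sub_smul hcorner hk1)).mul
    (isUnit_one_sub_smul norm_shiftRight_le hk1)).smul
      (Units.mk0 (-k)⁻¹ (inv_ne_zero (neg_ne_zero.2 hk)))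

/-! ### Compact perturbations -/

theorem isCompactOperator_diag {v : ℕ+ → ℂ} (hv : Memℓp v ∞) (h0 : Tendsto v atTop (𝓝 0)) :
    IsCompactOperator (diag v hv) := by
  -- `F N` is the diagonal operator of the truncation of `v` to the first `N` entries.
  set F : ℕ+ → H →L[ℂ] H := fun N => ∑ i ∈ Finset.Icc 1 N,
    (v i • lp.singleContinuousLinearMap ℂ (fun _ : ℕ+ => ℂ) 2 i) ∘L
      lp.evalCLM ℂ (fun _ : ℕ+ => ℂ) 2 i with hF
  have hFapply : ∀ N u n, F N u n = if n ≤ N then v n * u n else 0 := by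
    intro N u n
    have h1 : F N u = ∑ i ∈ Finset.Icc 1 N, v i • lp.single 2 i (u i) := by
      simp only [hF, sum_apply]
      rfl
    rw [h1, lp.coeFn_sum, Finset.sum_apply]
    have h2 : ∀ i, (v i • lp.single (E := fun _ : ℕ+ => ℂ) 2 i (u i) : H) n =
        if n = i then v i * u i else 0 := by
      intro i
      by_cases h : n = i
      · subst h
        simp
      · simp [h]
    simp only [h2, Finset.sum_ite_eq, Finset.mem_Icc, one_le, true_and]
  refine isCompactOperator_of_tendsto (F := F) (l := atTop) ?_ (Eventually.of_forall fun N => ?_)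
  · rw [Metric.tendsto_atTop]
    intro ε hε
    obtain ⟨N, hN⟩ := (Metric.tendsto_atTop.1 h0) (ε / 2) (by positivity)
    refine ⟨N, fun M hM => ?_⟩
    rw [dist_eq_norm]
    refine lt_of_le_of_lt (ContinuousLinearMap.opNorm_le_bound _ (by positivity) fun u => ?_)
      (half_lt_self hε)
    refine norm_le_of_forall_norm_apply_le (by positivity) fun n => ?_
    change ‖F M u n - diag v hv u n‖ ≤ ε / 2 * ‖u n‖
    rw [hFapply, diag_apply]
    split_ifs with h
    · simp only [sub_self, norm_zero]
      positivity
    · rw [zero_sub, norm_neg, norm_mul]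
      have := hN n (hM.le.trans (not_le.1 h).le)
      rw [dist_zero_right] at this
      gcongr
  · have hmem : F N ∈ compactOperator (RingHom.id ℂ) H H := by
      refine Submodule.sum_mem _ fun i _ => ?_
      exact (isCompactOperator_of_locallyCompactSpace_rng
        (v i • lp.singleContinuousLinearMap ℂ (fun _ : ℕ+ => ℂ) 2 i)).comp_clm
          (lp.evalCLM ℂ (fun _ : ℕ+ => ℂ) 2 i)
    exact hmem

/-- The Fredholm alternative for a compact perturbation of an invertible operator. -/
theorem isUnit_add_of_isCompactOperator {E : Type*} [NormedAddCommGroup E] [NormedSpace ℂ E]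
    [CompleteSpace E] {A K : E →L[ℂ] E} (hA : IsUnit A) (hK : IsCompactOperator K)
    (hinj : ∀ u, A u + K u = 0 → u = 0) : IsUnit (A + K) := by
  obtain ⟨A, rfl⟩ := hA
  set R : E →L[ℂ] E := ↑A⁻¹ with hR
  have hAR : (A : E →L[ℂ] E) * R = 1 := A.mul_inv
  have hcomp : IsCompactOperator (-(R * K) : E →L[ℂ] E) := (hK.clm_comp R).neg
  rcases hcomp.hasEigenvalue_or_mem_resolventSet (one_ne_zero (α := ℂ)) with h | h
  · obtain ⟨u, hu⟩ := h.exists_hasEigenvector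
    have h1 : -(R (K u)) = u := by simpa using hu.apply_eq_smul
    refine absurd (hinj u ?_) hu.2
    have h2 : (A : E →L[ℂ] E) (R (K u)) = K u := DFunLike.congr_fun hAR (K u)
    have h3 := congrArg (A : E →L[ℂ] E) h1
    rw [map_neg, h2] at h3
    rw [← h3, neg_add_cancel]
  · rw [spectrum.mem_resolventSet_iff, map_one, sub_neg_eq_add] at h
    have h4 : (A : E →L[ℂ] E) + K = A * (1 + R * K) := by
      rw [mul_add, mul_one, ← mul_assoc, hAR, one_mul]
    rw [h4]
    exact A.isUnit.mul h

/-! ### Approximate eigenvectors -/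

theorem shiftRight_single (i : ℕ+) (c : ℂ) :
    shiftRight (lp.single 2 i c) = lp.single (E := fun _ : ℕ+ => ℂ) 2 (i + 1) c := by
  ext n
  rw [shiftRight_apply]
  induction n using PNat.recOn with
  | one =>
    rw [prev_one, lp.single_apply_ne]
    exact (PNat.lt_add_left 1 i).ne
  | succ n _ =>
    rw [prev_add_one]
    by_cases h : n = i
    · subst h
      rw [lp.single_apply_self, lp.single_apply_self]
    · rw [lp.single_apply_ne _ _ _ h, lp.single_apply_ne]
      exact fun h' => h (add_right_cancel h')

/-- Truncated plane waves `∑ kⁿ eₙ` far out are approximate eigenvectors for `k + k⁻¹`: the factor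
`1 - kS` of `J_a - (k + k⁻¹)` sends them to a difference of two unit vectors, while the diagonal
part is small there. -/
theorem not_isUnit_J_add_diag_sub (a : ℝ) {v : ℕ+ → ℂ} (hv : Memℓp v ∞)
    (h0 : Tendsto v atTop (𝓝 0)) {k : ℂ} (hk : ‖k‖ = 1) :
    ¬ IsUnit (J a + diag v hv - algebraMap ℂ (H →L[ℂ] H) (k + k⁻¹)) := by
  rintro ⟨U, hU⟩
  have hk0 : k ≠ 0 := norm_ne_zero_iff.1 (by rw [hk]; exact one_ne_zero)
  set R : H →L[ℂ] H := ↑U⁻¹ with hR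
  set B : H →L[ℂ] H := (-k)⁻¹ • ((1 - k • shiftLeft) * (1 - k •
    diag (fun n => if n = 1 then (a : ℂ) else 0) (memℓp_corner a))) with hB
  set C : ℝ := ‖R‖ + 1 with hC
  have hC0 : 0 < C := by positivity
  obtain ⟨N, hN⟩ := (Metric.tendsto_atTop.1 h0) (1 / (2 * C)) (by positivity)
  set e : ℕ → ℕ+ := fun j => N + j.succPNat with he
  have hesucc : ∀ j, e (j + 1) = e j + 1 := by
    intro j
    simp only [he, add_assoc]
    rfl
  have heinj : Function.Injective e := fun i j h =>
    Nat.succPNat_injective (add_left_cancel h)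
  set ψ : ℕ → H := fun L => ∑ j ∈ Finset.range L, lp.single 2 (e j) (k ^ (e j : ℕ)) with hψ
  have hnormψ : ∀ L : ℕ, ‖ψ L‖ ^ 2 = L := by
    intro L
    have h := lp.norm_sum_single (E := fun _ : ℕ+ => ℂ) (p := 2) (by norm_num)
      (fun i : ℕ+ => k ^ (i : ℕ)) ((Finset.range L).map ⟨e, heinj⟩)
    simpa [hk] using h
  have htel : ∀ L, ‖(1 - k • shiftRight) (ψ L)‖ ≤ 2 := by
    intro L
    have h1 : (1 - k • shiftRight) (ψ L) = lp.single 2 (e 0) (k ^ (e 0 : ℕ)) -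
        lp.single 2 (e L) (k ^ (e L : ℕ)) := by
      rw [hψ, map_sum, ← Finset.sum_range_sub'
        (fun j => lp.single (E := fun _ : ℕ+ => ℂ) 2 (e j) (k ^ (e j : ℕ)))]
      refine Finset.sum_congr rfl fun j _ => ?_
      change lp.single 2 (e j) (k ^ (e j : ℕ)) -
        k • shiftRight (lp.single 2 (e j) (k ^ (e j : ℕ))) = _
      rw [shiftRight_single, ← lp.single_smul, hesucc, smul_eq_mul, ← pow_succ']
      rfl
    rw [h1]
    refine (norm_sub_le _ _).trans ?_
    rw [lp.norm_single two_pos, lp.norm_single two_pos, norm_pow, norm_pow, hk, one_pow, one_pow]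
    norm_num
  have hdiag : ∀ L, ‖diag v hv (ψ L)‖ ≤ 1 / (2 * C) * ‖ψ L‖ := by
    intro L
    refine norm_le_of_forall_norm_apply_le (by positivity) fun n => ?_
    rw [diag_apply, norm_mul]
    by_cases h : N ≤ n
    · have := hN n h
      rw [dist_zero_right] at this
      gcongr
    · have h2 : ψ L n = 0 := by
        simp only [hψ]
        rw [lp.coeFn_sum, Finset.sum_apply]
        refine Finset.sum_eq_zero fun j _ => lp.single_apply_ne _ _ _ ?_
        rintro rfl
        exact h (PNat.lt_add_right N _).le
      simp [h2]
  have hbound : ∀ L, ‖ψ L‖ ≤ 4 * C * ‖B‖ := by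
    intro L
    have h1 : ψ L = R (B ((1 - k • shiftRight) (ψ L)) + diag v hv (ψ L)) := by
      have h2 : (R * (J a + diag v hv - algebraMap ℂ (H →L[ℂ] H) (k + k⁻¹))) (ψ L) = ψ L := by
        rw [← hU, hR, Units.inv_mul]
        rfl
      rw [add_sub_right_comm, J_sub_eq_smul a hk0, ← smul_mul_assoc] at h2
      exact h2.symm
    have h3 : ‖ψ L‖ ≤ C * (‖B‖ * 2 + 1 / (2 * C) * ‖ψ L‖) := by
      conv_lhs => rw [h1]
      refine (R.le_opNorm _).trans ?_
      refine mul_le_mul (by rw [hC]; exact (lt_add_one _).le) ((norm_add_le _ _).trans ?_)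
        (norm_nonneg _) hC0.le
      exact add_le_add ((B.le_opNorm _).trans (by gcongr; exact htel L)) (hdiag L)
    have h4 : C * (1 / (2 * C) * ‖ψ L‖) = ‖ψ L‖ / 2 := by
      field_simp
    rw [mul_add, h4] at h3
    linarith
  obtain ⟨L, hL⟩ := exists_nat_gt ((4 * C * ‖B‖) ^ 2)
  have h5 : ‖ψ L‖ ^ 2 ≤ (4 * C * ‖B‖) ^ 2 := by
    gcongr
    exact hbound L
  rw [hnormψ] at h5
  linarith

/-! ### Adjoints -/

theorem adjoint_shiftRight : ContinuousLinearMap.adjoint shiftRight = shiftLeft := by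
  symm
  rw [ContinuousLinearMap.eq_adjoint_iff]
  intro x y
  have hinj : Function.Injective (fun n : ℕ+ => n + 1) := add_left_injective 1
  refine (lp.hasSum_inner (𝕜 := ℂ) (shiftLeft x) y).unique ?_
  have h := lp.hasSum_inner (𝕜 := ℂ) x (shiftRight y)
  rw [← hinj.hasSum_iff] at h
  · simpa [Function.comp_def, shiftRight_apply, shiftLeft_apply, prev_add_one] using h
  · intro n hn
    have : n = 1 := by
      by_contra h
      exact hn ⟨n - 1, PNat.sub_add_of_lt (lt_of_le_of_ne one_le (Ne.symm h))⟩
    subst this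
    simp [shiftRight_apply, prev_one]

theorem adjoint_diag {v : ℕ+ → ℂ} (hv : Memℓp v ∞) :
    ContinuousLinearMap.adjoint (diag v hv) = diag (star v) hv.star_mem := by
  symm
  rw [ContinuousLinearMap.eq_adjoint_iff]
  intro x y
  rw [lp.inner_eq_tsum, lp.inner_eq_tsum]
  refine tsum_congr fun n => ?_
  rw [diag_apply, diag_apply]
  simp
  ring

theorem adjoint_J_add_diag (a : ℝ) {v : ℕ+ → ℂ} (hv : Memℓp v ∞) :
    ContinuousLinearMap.adjoint (J a + diag v hv) = J a + diag (star v) hv.star_mem := by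
  have hleft : ContinuousLinearMap.adjoint shiftLeft = shiftRight := by
    rw [← adjoint_shiftRight, ContinuousLinearMap.adjoint_adjoint]
  rw [map_add, adjoint_diag, J, map_add, map_add, adjoint_shiftRight, hleft, adjoint_diag,
    add_comm shiftLeft]
  congr 2
  ext u n
  rw [diag_apply, diag_apply]
  by_cases h : n = 1 <;> simp [h]

/-! ### The parametrisation `z = k + k⁻¹` -/

/-- Inversion exchanges the two roots of `k ^ 2 - z k + 1`, so one of them lies in the closed unit
disc. -/
theorem exists_eq_add_inv (z : ℂ) : ∃ k : ℂ, k ≠ 0 ∧ ‖k‖ ≤ 1 ∧ z = k + k⁻¹ := by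
  obtain ⟨w, hw⟩ := IsAlgClosed.exists_pow_nat_eq (z ^ 2 - 4) (n := 2) two_pos
  have hmul : (z + w) / 2 * ((z - w) / 2) = 1 := by linear_combination (-1 / 4 : ℂ) * hw
  have hk : (z + w) / 2 ≠ 0 := left_ne_zero_of_mul_eq_one hmul
  have hinv : ((z + w) / 2)⁻¹ = (z - w) / 2 := inv_eq_of_mul_eq_one_right hmul
  rcases le_total ‖(z + w) / 2‖ 1 with h | h
  · refine ⟨_, hk, h, ?_⟩
    rw [hinv]
    ring
  · refine ⟨((z + w) / 2)⁻¹, inv_ne_zero hk, ?_, ?_⟩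
    · rw [norm_inv]
      exact inv_le_one_of_one_le₀ h
    · rw [inv_inv, hinv]
      ring

theorem add_inv_mem_interval {k : ℂ} (hk : ‖k‖ = 1) : k + k⁻¹ ∈ interval := by
  rw [Complex.inv_eq_conj hk, Complex.add_conj]
  refine ⟨2 * k.re, ?_, by norm_cast⟩
  have h := abs_le.1 (hk ▸ Complex.abs_re_le_norm k)
  exact ⟨by linarith [h.1], by linarith [h.2]⟩

theorem exists_norm_eq_one_of_mem_interval {z : ℂ} (hz : z ∈ interval) :
    ∃ k : ℂ, ‖k‖ = 1 ∧ z = k + k⁻¹ := by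
  obtain ⟨x, ⟨h1, h2⟩, rfl⟩ := hz
  refine ⟨Complex.exp (Real.arccos (x / 2) * Complex.I), Complex.norm_exp_ofReal_mul_I _, ?_⟩
  rw [← Complex.exp_neg, ← neg_mul, ← Complex.two_cos, ← Complex.ofReal_cos,
    Real.cos_arccos (by linarith) (by linarith)]
  push_cast
  ring

theorem exists_norm_lt_one_of_notMem_interval {z : ℂ} (hz : z ∉ interval) :
    ∃ k : ℂ, k ≠ 0 ∧ ‖k‖ < 1 ∧ z = k + k⁻¹ := by
  obtain ⟨k, hk, hk1, rfl⟩ := exists_eq_add_inv z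
  exact ⟨k, hk, lt_of_le_of_ne hk1 fun h => hz (add_inv_mem_interval h), rfl⟩

theorem hardyWeight_le_two {a q : ℝ} (ha0 : 0 ≤ a) (n : ℕ+) : hardyWeight a q n ≤ 2 := by
  have hn : (1 : ℝ) ≤ n := Nat.one_le_cast.2 n.pos
  have hle : 1 / (n : ℝ) ≤ 1 := (div_le_one (by linarith)).2 hn
  have h1 : 0 ≤ (1 - 1 / (n : ℝ)) ^ q := Real.rpow_nonneg (by linarith) q
  have h2 : 0 ≤ (1 + 1 / (n : ℝ)) ^ q := Real.rpow_nonneg (by positivity) q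
  have h3 : 0 ≤ a * (if n = 1 then 1 else 0) := by positivity
  rw [hardyWeight]
  linarith

/-! ### The spectrum of `J_a + V` -/

section Spectrum

variable {a q c : ℝ} {v : ℕ+ → ℂ}

theorem memℓp_of_le_hardyWeight (ha0 : 0 ≤ a) (hvw : ∀ n, ‖v n‖ ≤ hardyWeight a q n) :
    Memℓp v ∞ :=
  memℓp_infty ⟨2, by rintro _ ⟨n, rfl⟩; exact (hvw n).trans (hardyWeight_le_two ha0 n)⟩

theorem tendsto_of_le_hardyWeight (hvw : ∀ n, ‖v n‖ ≤ hardyWeight a q n) :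
    Tendsto v atTop (𝓝 0) :=
  squeeze_zero_norm hvw (tendsto_hardyWeight a q)

theorem interval_subset_spectrum (a : ℝ) (hv : Memℓp v ∞) (h0 : Tendsto v atTop (𝓝 0)) :
    interval ⊆ spectrum ℂ (J a + diag v hv) := by
  intro z hz
  obtain ⟨k, hk, rfl⟩ := exists_norm_eq_one_of_mem_interval hz
  rw [spectrum.mem_iff, IsUnit.sub_iff]
  exact not_isUnit_J_add_diag_sub a hv h0 hk

theorem eq_zero_of_apply_eq_smul (ha0 : 0 ≤ a) (ha1 : a < 1) (hq0 : 0 < q) (hc : 0 ≤ c)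
    {k : ℂ} (hk : k ≠ 0) (hk1 : ‖k‖ ≤ 1) (hkc : ‖k‖ * c < 1)
    (hvw : ∀ n, ‖v n‖ ≤ c * hardyWeight a q n) (hv : Memℓp v ∞) {u : H}
    (hu : (J a + diag v hv) u = (k + k⁻¹) • u) : u = 0 := by
  refine eq_zero_of_eigenvector ha0 ha1 hq0 hc hk hk1 hkc hvw fun n => ?_
  rw [← diag_apply v hv]
  exact congrArg (fun w : H => w n) hu

/-- Off `[-2, 2]` the operator `J_a - z` is invertible and `V` is compact, so that only eigenvalues
could occur; the contraction factor `‖k‖ < 1` excludes them, even though `v` is only bounded by the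
full Hardy weight. -/
theorem spectrum_subset_interval (ha0 : 0 ≤ a) (ha1 : a < 1) (hq0 : 0 < q)
    (hvw : ∀ n, ‖v n‖ ≤ hardyWeight a q n) (hv : Memℓp v ∞) :
    spectrum ℂ (J a + diag v hv) ⊆ interval := by
  intro z hz
  by_contra hzi
  obtain ⟨k, hk, hk1, rfl⟩ := exists_norm_lt_one_of_notMem_interval hzi
  rw [spectrum.mem_iff, IsUnit.sub_iff, add_sub_right_comm] at hz
  refine hz (isUnit_add_of_isCompactOperator (isUnit_J_sub ha0 ha1 hk hk1)
    (isCompactOperator_diag hv (tendsto_of_le_hardyWeight hvw)) fun u hu => ?_)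
  refine eq_zero_of_apply_eq_smul ha0 ha1 hq0 zero_le_one hk hk1.le (by rwa [mul_one])
    (by simpa using hvw) hv ?_
  have h : J a u - (k + k⁻¹) • u + diag v hv u = 0 := hu
  rw [← sub_eq_zero, ← h, add_apply]
  abel

/-- On `[-2, 2]`, where `‖k‖ = 1`, the contraction comes from `c < 1` instead. -/
theorem injective_of_mem_interval (ha0 : 0 ≤ a) (ha1 : a < 1) (hq0 : 0 < q) (hc : 0 ≤ c)
    (hc1 : c < 1) (hvw : ∀ n, ‖v n‖ ≤ c * hardyWeight a q n) (hv : Memℓp v ∞) {z : ℂ}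
    (hz : z ∈ interval) :
    Function.Injective (J a + diag v hv - algebraMap ℂ (H →L[ℂ] H) z) := by
  obtain ⟨k, hk, rfl⟩ := exists_norm_eq_one_of_mem_interval hz
  have hk0 : k ≠ 0 := norm_ne_zero_iff.1 (by rw [hk]; exact one_ne_zero)
  refine (injective_iff_map_eq_zero _).2 fun u hu => ?_
  exact eq_zero_of_apply_eq_smul ha0 ha1 hq0 hc hk0 hk.le (by rwa [hk, one_mul]) hvw hv
    (sub_eq_zero.1 hu)

/-- The range is dense because the adjoint `J_a + V* - z` has the same form, hence is injective. -/
theorem interval_subset_continuousSpectrum (ha0 : 0 ≤ a) (ha1 : a < 1) (hq0 : 0 < q)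
    (hc : 0 ≤ c) (hc1 : c < 1) (hvw : ∀ n, ‖v n‖ ≤ c * hardyWeight a q n) (hv : Memℓp v ∞)
    (h0 : Tendsto v atTop (𝓝 0)) :
    interval ⊆ continuousSpectrum (J a + diag v hv) := by
  intro z hz
  have hinj := injective_of_mem_interval ha0 ha1 hq0 hc hc1 hvw hv hz
  refine ⟨hinj, ?_, fun hsurj => ?_⟩
  · have hstar : star z = z := by
      obtain ⟨x, -, rfl⟩ := hz
      exact Complex.conj_ofReal x
    have hadj : ContinuousLinearMap.adjoint
        (J a + diag v hv - algebraMap ℂ (H →L[ℂ] H) z) =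
        J a + diag (star v) hv.star_mem - algebraMap ℂ (H →L[ℂ] H) z := by
      rw [map_sub, adjoint_J_add_diag, ← ContinuousLinearMap.star_eq_adjoint,
        ← algebraMap_star_comm, hstar]
    have hinj' := injective_of_mem_interval (v := star v) ha0 ha1 hq0 hc hc1
      (fun n => by simpa using hvw n) hv.star_mem hz
    have hdense : (LinearMap.range (J a + diag v hv -
        algebraMap ℂ (H →L[ℂ] H) z).toLinearMap).topologicalClosure = ⊤ := by
      rw [Submodule.topologicalClosure_eq_top_iff, ContinuousLinearMap.orthogonal_range, hadj]
      exact LinearMap.ker_eq_bot.2 hinj'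
    exact Submodule.dense_iff_topologicalClosure_eq_top.2 hdense
  · have hmem := interval_subset_spectrum a hv h0 hz
    rw [spectrum.mem_iff, IsUnit.sub_iff] at hmem
    exact hmem (ContinuousLinearMap.isUnit_iff_bijective.2 ⟨hinj, hsurj⟩)

theorem continuousSpectrum_subset_spectrum {E : Type*} [NormedAddCommGroup E] [NormedSpace ℂ E]
    (T : E →L[ℂ] E) : continuousSpectrum T ⊆ spectrum ℂ T := by
  rintro z ⟨-, -, hsurj⟩
  rw [spectrum.mem_iff, IsUnit.sub_iff]
  rintro ⟨U, hU⟩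
  refine hsurj fun y => ⟨(↑U⁻¹ : E →L[ℂ] E) y, ?_⟩
  rw [← hU]
  exact DFunLike.congr_fun U.mul_inv y

/-- No point of `[-2, 2]` is isolated in a set containing `[-2, 2]`. -/
theorem closedBall_inter_ne_singleton {S : Set ℂ} (hS : interval ⊆ S) {z : ℂ} (hz : z ∈ interval)
    {r : ℝ} (hr : 0 < r) : Metric.closedBall z r ∩ S ≠ {z} := by
  obtain ⟨x, ⟨h1, h2⟩, rfl⟩ := hz
  intro h
  have key : ∀ y : ℝ, -2 ≤ y → y ≤ 2 → |y - x| ≤ r → y = x := by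
    intro y hy1 hy2 hy
    have hmem : (y : ℂ) ∈ Metric.closedBall (x : ℂ) r ∩ S := by
      refine ⟨?_, hS ⟨y, ⟨hy1, hy2⟩, rfl⟩⟩
      rwa [Metric.mem_closedBall, dist_eq_norm, ← Complex.ofReal_sub, Complex.norm_real]
    rw [h] at hmem
    exact Complex.ofReal_injective hmem
  have hm : 0 < min r 1 := lt_min hr one_pos
  have hm1 : min r 1 ≤ 1 := min_le_right _ _
  have hmr : min r 1 ≤ r := min_le_left _ _
  rcases le_total x 0 with hx | hx
  · have := key (x + min r 1) (by linarith) (by linarith) (by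
      rw [add_sub_cancel_left, abs_of_pos hm]
      exact hmr)
    linarith
  · have := key (x - min r 1) (by linarith) (by linarith) (by
      rw [sub_sub_cancel_left, abs_neg, abs_of_pos hm]
      exact hmr)
    linarith

end Spectrum
end RobinSchrodinger

theorem theorem5p6 (a : ℝ) (ha0 : 0 ≤ a) (ha1 : a < 1)
    (q : ℝ) (hq0 : 0 < q) (hqa : q ≤ RobinSchrodinger.qMax a) (v : ℕ+ → ℂ) :
    (∀ c : ℝ, c < 1 → (∀ n : ℕ+, ‖v n‖ ≤ c * RobinSchrodinger.hardyWeight a q n) →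
      ∃ hv : Memℓp v ∞,
        spectrum ℂ (RobinSchrodinger.J a + RobinSchrodinger.diag v hv) =
            RobinSchrodinger.interval ∧
          RobinSchrodinger.continuousSpectrum
              (RobinSchrodinger.J a + RobinSchrodinger.diag v hv) =
            RobinSchrodinger.interval) ∧
    ((∀ n : ℕ+, ‖v n‖ ≤ RobinSchrodinger.hardyWeight a q n) →
      ∃ hv : Memℓp v ∞,
        RobinSchrodinger.discreteSpectrum
            (RobinSchrodinger.J a + RobinSchrodinger.diag v hv) = ∅) := by
  have hw := RobinSchrodinger.hardyWeight_nonneg ha1 hq0 hqa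
  refine ⟨fun c hc1 hcv => ?_, fun hvw => ?_⟩
  · -- A nonpositive `c` is not excluded by hypothesis, hence the constant `max c 0` below.
    have hvw : ∀ n, ‖v n‖ ≤ RobinSchrodinger.hardyWeight a q n := fun n =>
      (hcv n).trans (mul_le_of_le_one_left (hw n) hc1.le)
    have hcv' : ∀ n, ‖v n‖ ≤ max c 0 * RobinSchrodinger.hardyWeight a q n := fun n =>
      (hcv n).trans (mul_le_mul_of_nonneg_right (le_max_left _ _) (hw n))
    have hv := RobinSchrodinger.memℓp_of_le_hardyWeight ha0 hvw
    have h0 := RobinSchrodinger.tendsto_of_le_hardyWeight hvw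
    have hsub := RobinSchrodinger.spectrum_subset_interval ha0 ha1 hq0 hvw hv
    refine ⟨hv, hsub.antisymm (RobinSchrodinger.interval_subset_spectrum a hv h0), ?_⟩
    exact ((RobinSchrodinger.continuousSpectrum_subset_spectrum _).trans hsub).antisymm
      (RobinSchrodinger.interval_subset_continuousSpectrum ha0 ha1 hq0 (le_max_right _ _)
        (max_lt hc1 one_pos) hcv' hv h0)
  · have hv := RobinSchrodinger.memℓp_of_le_hardyWeight ha0 hvw
    have h0 := RobinSchrodinger.tendsto_of_le_hardyWeight hvw
    refine ⟨hv, Set.eq_empty_of_forall_notMem ?_⟩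
    -- The spectrum is `[-2, 2]`, which has no isolated points.
    rintro z ⟨-, r, hr, hball, -⟩
    have hz : z ∈ spectrum ℂ (RobinSchrodinger.J a + RobinSchrodinger.diag v hv) :=
      (hball.symm.subset rfl).2
    exact RobinSchrodinger.closedBall_inter_ne_singleton
      (RobinSchrodinger.interval_subset_spectrum a hv h0)
      (RobinSchrodinger.spectrum_subset_interval ha0 ha1 hq0 hvw hv hz) hr hball
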